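/- For an integral domain $D$ with quotient field $Q(D)$, let $D^*$ denote the complete integral closure of $D$: the set of all $x\in Q(D)$ for which there is $0\ne d\in D$ with $dx^i\in D$ for all $i\ge 0$. $D$ is completely integrally closed if $D=D^*$. For subsets $I,J$ of $Q(D)$ put $(J:I)=\{x\in Q(D) : xI\subseteq J\}$. An ideal $I$ of $D$ is strongly divisorial if $I\neq 0$, $(D:I)=(I:I)$ and $(D:(D:I))=I$. Let $A$ be an integral domain with $A\ne A^*$ and let $0\ne a\in(A:A^*)$. Let $T_0$ and $T_{\varepsilon_1\cdots\varepsilon_n0}$ ($n\ge1$, $\varepsilon_i\in\{0,1\}$) be independent indeterminates over $A$, and define inductively, in the field of rational functions in these indeterminates over the quotient field of $A$, $$T_1=\frac a{T_0},\qquad T_{\varepsilon_1\cdots\varepsilon_n1}=\frac{T_{\varepsilon_1\cdots\varepsilon_n}}{T_{\varepsilon_1\cdots\varepsilon_n0}}\quad(n\ge1).$$ Let $R=A[T_{\varepsilon_1\cdots\varepsilon_n} : n\ge1,\ \varepsilon_1,\dots,\varepsilon_n\in\{0,1\}]$, $R_0=A$, and $R_n=A[T_{\varepsilon_1\cdots\varepsilon_k}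 : 1\le k\le n,\ \varepsilon_1,\dots,\varepsilon_k\in\{0,1\}]$ for $n\ge1$. Then: 1. $R^*=\bigcup_{n=0}^\infty R_n^*$; 2. $R$ is not completely integrally closed and $a\in(R:R^*)$; in particular $(R:R^*)\ne(0)$; 3. $R$ has no strongly divisorial prime ideals. Moreover, $R$ has infinite Krull dimension. -/

import Mathlib

/-- A domain `D` with quotient field `F` is completely integrally closed if the complete integral
closure `D*` of `D` in `F` is `D` itself (`⊥` is the image of `D` in `F`). -/
def IsCompletelyIntegrallyClosed (D F : Type*) [CommRing D] [IsDomain D] [Field F] [Algebra D F]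
    [IsFractionRing D F] : Prop :=
  completeIntegralClosure D F = ⊥

/-- The conductor `(D : D*) = {x ∈ F | x D* ⊆ D}`, where `F` is the quotient field of `D` and `D*`
is the complete integral closure of `D` in `F`. Here `1` is the image of `D` in `F`, and the
quotient `J / I` of submodules of `F` is `{x ∈ F | x I ⊆ J}`. -/
noncomputable def conductorCompleteIntegralClosure (D F : Type*) [CommRing D] [IsDomain D]
    [Field F] [Algebra D F] [IsFractionRing D F] : Submodule D F :=
  1 / Subalgebra.toSubmodule (completeIntegralClosure D F)

/-- An ideal `I` of a domain `D` with quotient field `F` is strongly divisorial if it is nonzero,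
strong, i.e. `(D : I) = (I : I)`, and divisorial, i.e. `(D : (D : I)) = I`; all the conductors
are taken in `F`. -/
def IsStronglyDivisorial {D : Type*} (F : Type*) [CommRing D] [IsDomain D] [Field F] [Algebra D F]
    [IsFractionRing D F] (I : Ideal D) : Prop :=
  I ≠ ⊥ ∧
  (1 / IsLocalization.coeSubmodule F I : Submodule D F) =
    IsLocalization.coeSubmodule F I / IsLocalization.coeSubmodule F I ∧
  (1 / (1 / IsLocalization.coeSubmodule F I) : Submodule D F) = IsLocalization.coeSubmodule F I

namespace ReesTower

/-- The field of rational functions over `A` in independent indeterminates indexed by all the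
finite binary words; the indeterminate of index `ε` plays the role of `T_{ε0}`. -/
abbrev RatField (A : Type*) [CommRing A] [IsDomain A] : Type _ :=
  FractionRing (MvPolynomial (List Bool) A)

/-- The elements `T_ε`. The word `ε₁ε₂…εₙ` is encoded by the list `[εₙ, …, ε₂, ε₁]`, with `false`
for `0` and `true` for `1`, so that appending a letter to the right of a word is `List.cons`.
The empty word gets the value `a`: thus `T_1 = a / T_0`, `T_{ε1} = T_ε / T_{ε0}`, and the
`T_{ε0}` (with `ε` any word, possibly empty) are the independent indeterminates. -/
noncomputable def T {A : Type*} [CommRing A] [IsDomain A] (a : A) : List Bool → RatField A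
  | [] => algebraMap A (RatField A) a
  | false :: ε => algebraMap (MvPolynomial (List Bool) A) (RatField A) (MvPolynomial.X ε)
  | true :: ε => T a ε / algebraMap (MvPolynomial (List Bool) A) (RatField A) (MvPolynomial.X ε)

/-- `R = A[T_ε | ε a nonempty finite binary word]`. -/
noncomputable def R {A : Type*} [CommRing A] [IsDomain A] (a : A) : Subalgebra A (RatField A) :=
  Algebra.adjoin A {x | ∃ ε : List Bool, 1 ≤ ε.length ∧ x = T a ε}

/-- `R_n = A[T_ε | ε a binary word of length between 1 and n]`; in particular `R_0 = A`. -/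
noncomputable def Rn {A : Type*} [CommRing A] [IsDomain A] (a : A) (n : ℕ) :
    Subalgebra A (RatField A) :=
  Algebra.adjoin A {x | ∃ ε : List Bool, 1 ≤ ε.length ∧ ε.length ≤ n ∧ x = T a ε}

/-- The ambient field of rational functions is the quotient field of `R`. -/
instance isFractionRing_R {A : Type*} [CommRing A] [IsDomain A] (a : A) :
    IsFractionRing (R a) (RatField A) := by
  have key : ∀ p : MvPolynomial (List Bool) A,
      algebraMap (MvPolynomial (List Bool) A) (RatField A) p ∈ R a := by
    intro p
    induction p using MvPolynomial.induction_on with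
    | C c =>
      have h : algebraMap (MvPolynomial (List Bool) A) (RatField A) (MvPolynomial.C c) =
          algebraMap A (RatField A) c := by
        rw [IsScalarTower.algebraMap_apply A (MvPolynomial (List Bool) A) (RatField A)]
        rfl
      rw [h]
      exact (R a).algebraMap_mem c
    | add p q hp hq => rw [map_add]; exact (R a).add_mem hp hq
    | mul_X p ε hp =>
      rw [map_mul]
      exact (R a).mul_mem hp (Algebra.subset_adjoin ⟨false :: ε, by simp, by simp [T]⟩)
  refine IsFractionRing.of_field (R a) (RatField A) fun z => ?_
  obtain ⟨p, q, _, h⟩ := IsFractionRing.div_surjective (A := MvPolynomial (List Bool) A) z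
  exact ⟨⟨_, key p⟩, ⟨_, key q⟩, h.symm⟩

/-- An element of the ambient field that is almost integral over a subalgebra `S` lies in the
quotient field of `S`. Hence the complete integral closure of `S` in the ambient field is the
complete integral closure of `S` in its own quotient field. -/
theorem mem_closure_of_isAlmostIntegral {A : Type*} [CommRing A] [IsDomain A]
    (S : Subalgebra A (RatField A)) (x : RatField A) (hx : IsAlmostIntegral S x) :
    x ∈ Subfield.closure (S : Set (RatField A)) := by
  obtain ⟨r, hr, h⟩ := hx
  obtain ⟨y, hy⟩ := h 1
  have hr0 : (r : RatField A) ≠ 0 := fun h0 => nonZeroDivisors.ne_zero hr (Subtype.ext h0)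
  have hxy : x = (y : RatField A) / (r : RatField A) := by
    rw [eq_div_iff hr0, mul_comm]
    rw [pow_one, Algebra.smul_def] at hy
    exact hy.symm
  rw [hxy]
  exact div_mem (Subfield.subset_closure y.2) (Subfield.subset_closure r.2)

end ReesTower

/-! Everything rests on one step `B ⊆ S = B[t, b / t]`, with `t` transcendental over a field `k ⊇ B`
and `0 ≠ b ∈ B`. Inside `k[t, 1/t]`, the ring `S` consists of the Laurent polynomials whose
coefficient of `t ^ j` lies in `B` for `j ≥ 0` and in `b ^ (-j) B` for `j < 0` (`IsReesForm`). Hence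
`S ∩ k = B`, and `x ∈ k` lies in `B` as soon as `x t` or `x (b / t)` lies in `S`. Moreover an
element almost integral over `S` is a Laurent polynomial whose top coefficient is, up to the
required power of `b`, almost integral over `B`. Peeling off top terms shows that `a B* ⊆ B` implies
`a S* ⊆ S` (`mul_mem_reesStep_of_isAlmostIntegral`).

Each `R_n` arises from `A` by finitely many such steps with `b = T_ε`, `t = T_{ε0}`. So `R ∩ Q(R_n)
= R_n`, which gives `R* = ⋃ R_n*`, and `a R* ⊆ R`.

If a prime `P` were strongly divisorial, then `(R : P) ⊆ R*`, so `a ∈ P`, and some `x ∈ (R : P)`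
lies outside `R`; say `x ∈ R_n*`. Since `T_ε = T_{ε0} T_{ε1}`, primality yields a word `w` of length
`n + 1` with `T_w ∈ P`. Then `x T_w ∈ R` forces `x ∈ R_n`, a contradiction.

For the dimension, primes of the polynomial ring containing no indeterminate extend to `R`, and they
form infinite chains. -/

section ReesStep

open Polynomial

variable {A K : Type*} [CommRing A] [Field K] [Algebra A K]

/-! ### Almost integrality over a subalgebra of a field -/

theorem Subalgebra.isAlmostIntegral_iff (S : Subalgebra A K) (x : K) :
    IsAlmostIntegral S x ↔ ∃ d ∈ S, d ≠ 0 ∧ ∀ i : ℕ, d * x ^ i ∈ S := by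
  constructor
  · rintro ⟨r, hr, h⟩
    refine ⟨r, r.2, fun h0 => nonZeroDivisors.ne_zero hr (Subtype.ext h0), fun i => ?_⟩
    obtain ⟨y, hy⟩ := h i
    rw [Algebra.smul_def] at hy
    exact hy ▸ y.2
  · rintro ⟨d, hd, hd0, h⟩
    refine ⟨⟨d, hd⟩, mem_nonZeroDivisors_of_ne_zero fun h0 => hd0 (congrArg Subtype.val h0),
      fun i => ⟨⟨_, h i⟩, ?_⟩⟩
    rw [Algebra.smul_def]
    rfl

theorem Subalgebra.isAlmostIntegral_mono {S S' : Subalgebra A K} (h : S ≤ S') {x : K}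
    (hx : IsAlmostIntegral S x) : IsAlmostIntegral S' x := by
  rw [Subalgebra.isAlmostIntegral_iff] at hx ⊢
  obtain ⟨d, hd, hd0, hi⟩ := hx
  exact ⟨d, h hd, hd0, fun i => h (hi i)⟩

theorem Subalgebra.isAlmostIntegral_of_mem {S : Subalgebra A K} {x : K} (hx : x ∈ S) :
    IsAlmostIntegral S x := by
  rw [Subalgebra.isAlmostIntegral_iff]
  exact ⟨1, S.one_mem, one_ne_zero, fun i => by rw [one_mul]; exact S.pow_mem hx i⟩

/-! ### The step from `B` to `B[t, b / t]`: membership read off coefficients -/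

/-- The algebra `B[t, b / t]`. -/
def reesStep (B : Subalgebra A K) (b t : K) : Subalgebra A K :=
  Algebra.adjoin A ((B : Set K) ∪ {t, b / t})

/-- The `i`-th coefficient of `p` lies in `b ^ (n - i) B`, with truncated subtraction: this says
that `p(t) / t ^ n` lies in `B[t, b / t]`. -/
def IsReesForm (B : Subalgebra A K) {k : Subfield K} (b : K) (n : ℕ) (p : k[X]) : Prop :=
  ∀ i, ∃ β ∈ B, (p.coeff i : K) = b ^ (n - i) * β

variable {B : Subalgebra A K} {k : Subfield K} {b t : K}

theorem le_reesStep (B : Subalgebra A K) (b t : K) : B ≤ reesStep B b t :=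
  fun _ hx => Algebra.subset_adjoin (Or.inl hx)

theorem self_mem_reesStep (B : Subalgebra A K) (b t : K) : t ∈ reesStep B b t :=
  Algebra.subset_adjoin (by simp)

theorem div_mem_reesStep (B : Subalgebra A K) (b t : K) : b / t ∈ reesStep B b t :=
  Algebra.subset_adjoin (by simp)

theorem monomial_mem_reesStep (ht : t ≠ 0) {β : K} (hβ : β ∈ B) (n i : ℕ) :
    b ^ (n - i) * β * t ^ i / t ^ n ∈ reesStep B b t := by
  have hβ' := le_reesStep B b t hβ
  rcases le_total n i with h | h
  · obtain ⟨j, rfl⟩ := Nat.exists_eq_add_of_le h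
    have : b ^ (n - (n + j)) * β * t ^ (n + j) / t ^ n = β * t ^ j := by
      rw [Nat.sub_eq_zero_of_le h, pow_add]; field_simp
    rw [this]
    exact mul_mem hβ' (pow_mem (self_mem_reesStep B b t) _)
  · obtain ⟨j, rfl⟩ := Nat.exists_eq_add_of_le h
    have : b ^ (i + j - i) * β * t ^ i / t ^ (i + j) = β * (b / t) ^ j := by
      rw [Nat.add_sub_cancel_left, pow_add, div_pow]; field_simp
    rw [this]
    exact mul_mem hβ' (pow_mem (div_mem_reesStep B b t) _)

theorem IsReesForm.X_pow_mul {n : ℕ} {p : k[X]} (hp : IsReesForm B b n p) (m : ℕ) :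
    IsReesForm B b (m + n) (X ^ m * p) := by
  intro i
  rw [coeff_X_pow_mul']
  split_ifs with h
  · obtain ⟨β, hβ, e⟩ := hp (i - m)
    refine ⟨β, hβ, ?_⟩
    rw [e]
    congr 2
    lia
  · exact ⟨0, zero_mem _, by simp⟩

theorem IsReesForm.of_X_pow_mul {n m : ℕ} {p : k[X]} (hp : IsReesForm B b (m + n) (X ^ m * p)) :
    IsReesForm B b n p := by
  intro i
  obtain ⟨β, hβ, e⟩ := hp (i + m)
  rw [coeff_X_pow_mul] at e
  exact ⟨β, hβ, by rw [e]; congr 2; lia⟩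

theorem IsReesForm.add {n : ℕ} {p q : k[X]} (hp : IsReesForm B b n p) (hq : IsReesForm B b n q) :
    IsReesForm B b n (p + q) := by
  intro i
  obtain ⟨β, hβ, e⟩ := hp i
  obtain ⟨γ, hγ, f⟩ := hq i
  exact ⟨β + γ, add_mem hβ hγ, by rw [coeff_add, Subfield.coe_add, e, f]; ring⟩

theorem IsReesForm.mul (hb : b ∈ B) {n m : ℕ} {p q : k[X]} (hp : IsReesForm B b n p)
    (hq : IsReesForm B b m q) : IsReesForm B b (n + m) (p * q) := by
  intro l
  choose f hf hf' using hp
  choose g hg hg' using hq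
  refine ⟨∑ x ∈ Finset.HasAntidiagonal.antidiagonal l,
    b ^ ((n - x.1) + (m - x.2) - (n + m - l)) * (f x.1 * g x.2), ?_, ?_⟩
  · exact sum_mem fun x _ => mul_mem (pow_mem hb _) (mul_mem (hf _) (hg _))
  · rw [coeff_mul, Finset.mul_sum, AddSubmonoidClass.coe_finsetSum]
    refine Finset.sum_congr rfl fun x hx => ?_
    rw [Finset.HasAntidiagonal.mem_antidiagonal] at hx
    -- Truncated subtraction is superadditive here: `(n - i) + (m - j) ≥ n + m - (i + j)`. The
    -- surplus power of `b` is absorbed into the coefficient.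
    have e : n - x.1 + (m - x.2) = n + m - l + ((n - x.1) + (m - x.2) - (n + m - l)) := by lia
    rw [Subfield.coe_mul, hf', hg', ← mul_assoc (b ^ (n + m - l)), ← pow_add, ← e, pow_add]
    ring

theorem isReesForm_C (b : K) {x : K} (hx : x ∈ B) (hk : x ∈ k) :
    IsReesForm B b 0 (C (⟨x, hk⟩ : k)) := by
  intro i
  rw [coeff_C]
  split_ifs
  · exact ⟨x, hx, by simp⟩
  · exact ⟨0, zero_mem _, by simp⟩

theorem exists_isReesForm (hBk : ∀ x ∈ B, x ∈ k) (hb : b ∈ B) (ht : t ≠ 0) {y : K}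
    (hy : y ∈ reesStep B b t) :
    ∃ (n : ℕ) (p : k[X]), IsReesForm B b n p ∧ t ^ n * y = aeval t p := by
  induction hy using Algebra.adjoin_induction with
  | mem x hx =>
    rcases hx with hx | rfl | rfl
    · exact ⟨0, C ⟨x, hBk x hx⟩, isReesForm_C b hx _, by
        rw [aeval_C, pow_zero, one_mul]; rfl⟩
    · refine ⟨0, X, fun i => ?_, by simp⟩
      rw [coeff_X]
      split_ifs
      · exact ⟨1, one_mem _, by simp⟩
      · exact ⟨0, zero_mem _, by simp⟩
    · refine ⟨1, C ⟨b, hBk b hb⟩, fun i => ?_, ?_⟩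
      · rw [coeff_C]
        split_ifs with h
        · exact ⟨1, one_mem _, by simp [h]⟩
        · exact ⟨0, zero_mem _, by simp⟩
      · rw [aeval_C, pow_one, mul_div_cancel₀ _ ht]; rfl
  | algebraMap c =>
    exact ⟨0, C ⟨_, hBk _ (B.algebraMap_mem c)⟩, isReesForm_C b (B.algebraMap_mem c) _, by
      rw [aeval_C, pow_zero, one_mul]; rfl⟩
  | add x y _ _ hx hy =>
    obtain ⟨n, p, hp, e⟩ := hx
    obtain ⟨m, q, hq, f⟩ := hy
    refine ⟨m + n, X ^ m * p + X ^ n * q,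
      (hp.X_pow_mul m).add (add_comm n m ▸ hq.X_pow_mul n), ?_⟩
    simp only [map_add, map_mul, map_pow, aeval_X, ← e, ← f]
    ring
  | mul x y _ _ hx hy =>
    obtain ⟨n, p, hp, e⟩ := hx
    obtain ⟨m, q, hq, f⟩ := hy
    refine ⟨n + m, p * q, hp.mul hb hq, ?_⟩
    rw [map_mul, ← e, ← f]
    ring

theorem ne_zero_of_transcendental (ht : Transcendental k t) : t ≠ 0 :=
  fun h => ht (h ▸ isAlgebraic_zero)

/-- Transcendence of `t` makes the numerator unique up to a power of `X`, and the coefficient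
condition is invariant under that shift. So every numerator of `y`, not just a suitable one,
satisfies it. -/
theorem isReesForm_of_mem_reesStep (hBk : ∀ x ∈ B, x ∈ k) (hb : b ∈ B) (ht : Transcendental k t)
    {y : K} (hy : y ∈ reesStep B b t) {m : ℕ} {q : k[X]} (hq : t ^ m * y = aeval t q) :
    IsReesForm B b m q := by
  have ht0 : t ≠ 0 := ne_zero_of_transcendental ht
  obtain ⟨n, p, hp, e⟩ := exists_isReesForm hBk hb ht0 hy
  have h : X ^ n * q = X ^ m * p := by
    apply transcendental_iff_injective.mp ht
    simp only [map_mul, map_pow, aeval_X, ← e, ← hq]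
    ring
  apply IsReesForm.of_X_pow_mul (m := n)
  rw [h, add_comm]
  exact hp.X_pow_mul m

theorem mem_of_mul_mem_reesStep (hBk : ∀ x ∈ B, x ∈ k) (hb : b ∈ B) (ht : Transcendental k t)
    {x : K} (hx : x ∈ k) (h : x * t ∈ reesStep B b t) : x ∈ B := by
  obtain ⟨β, hβ, e⟩ := isReesForm_of_mem_reesStep hBk hb ht h (m := 0) (q := C ⟨x, hx⟩ * X)
    (by rw [map_mul, aeval_C, aeval_X, pow_zero, one_mul]; rfl) 1
  rw [coeff_C_mul_X] at e
  simp only [if_true, Nat.zero_sub, pow_zero, one_mul] at e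
  exact e ▸ hβ

/-- The numerator of `x * (b / t)` over `t ^ 1` is the constant `x * b`, which must lie in `b B`;
cancel `b`. -/
theorem mem_of_mul_div_mem_reesStep (hBk : ∀ x ∈ B, x ∈ k) (hb : b ∈ B) (hb0 : b ≠ 0)
    (ht : Transcendental k t) {x : K} (hx : x ∈ k) (h : x * (b / t) ∈ reesStep B b t) :
    x ∈ B := by
  have ht0 : t ≠ 0 := ne_zero_of_transcendental ht
  obtain ⟨β, hβ, e⟩ := isReesForm_of_mem_reesStep hBk hb ht h (m := 1)
    (q := C (⟨x, hx⟩ * ⟨b, hBk b hb⟩))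
    (by
      rw [aeval_C, pow_one, map_mul]
      change _ = x * b
      field_simp) 0
  rw [coeff_C_zero] at e
  simp only [Subfield.coe_mul, Nat.sub_zero, pow_one] at e
  rw [mul_comm] at e
  exact mul_left_cancel₀ hb0 e ▸ hβ

theorem mem_of_mem_reesStep (hBk : ∀ x ∈ B, x ∈ k) (hb : b ∈ B) (ht : Transcendental k t)
    {x : K} (hx : x ∈ k) (h : x ∈ reesStep B b t) : x ∈ B :=
  mem_of_mul_mem_reesStep hBk hb ht hx (mul_mem h (self_mem_reesStep B b t))

/-! ### Elements almost integral over `B[t, b / t]` -/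

/-- A fraction almost integral over `k[t, 1 / t]` lies in `k[t, 1 / t]`. -/
theorem exists_pow_mul_eq_aeval (hBk : ∀ x ∈ B, x ∈ k) (hb : b ∈ B) (ht : Transcendental k t)
    {y : K} (hy : IsAlmostIntegral (reesStep B b t) y) :
    ∃ (n : ℕ) (p : k[X]), t ^ n * y = aeval t p := by
  have ht0 : t ≠ 0 := ne_zero_of_transcendental ht
  classical
  have inj := transcendental_iff_injective.mp ht
  rw [Subalgebra.isAlmostIntegral_iff] at hy
  obtain ⟨d, hd, hd0, h⟩ := hy
  obtain ⟨n₀, D, -, hD⟩ := exists_isReesForm hBk hb ht0 hd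
  obtain ⟨n₁, E, -, hE⟩ := exists_isReesForm hBk hb ht0 (h 1)
  have hD0 : D ≠ 0 := by
    rintro rfl
    rw [map_zero] at hD
    exact mul_ne_zero (pow_ne_zero _ ht0) hd0 hD
  have hQ0 : X ^ n₁ * D ≠ 0 := mul_ne_zero (pow_ne_zero _ X_ne_zero) hD0
  -- write `y` as a reduced fraction `P / Q`
  obtain ⟨P, Q, hQ, hcop, hPQ⟩ : ∃ P Q : k[X], Q ≠ 0 ∧ IsCoprime P Q ∧
      aeval t Q * y = aeval t P := by
    obtain ⟨P, Q, g, hcop, e₁, e₂⟩ :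
        ∃ P Q g : k[X], IsCoprime P Q ∧ X ^ n₀ * E = g * P ∧ X ^ n₁ * D = g * Q := by
      obtain ⟨P, hP⟩ := EuclideanDomain.gcd_dvd_left (X ^ n₀ * E) (X ^ n₁ * D)
      obtain ⟨Q, hQ⟩ := EuclideanDomain.gcd_dvd_right (X ^ n₀ * E) (X ^ n₁ * D)
      refine ⟨P, Q, _, ?_, hP, hQ⟩
      have hg : EuclideanDomain.gcd (X ^ n₀ * E) (X ^ n₁ * D) ≠ 0 := by
        intro h0
        rw [h0, zero_mul] at hQ
        exact hQ0 hQ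
      have := EuclideanDomain.gcd_eq_gcd_ab (X ^ n₀ * E) (X ^ n₁ * D)
      set g := EuclideanDomain.gcd (X ^ n₀ * E) (X ^ n₁ * D)
      set u := EuclideanDomain.gcdA (X ^ n₀ * E) (X ^ n₁ * D)
      set v := EuclideanDomain.gcdB (X ^ n₀ * E) (X ^ n₁ * D)
      refine ⟨u, v, mul_left_cancel₀ hg ?_⟩
      calc g * (u * P + v * Q) = (g * P) * u + (g * Q) * v := by ring
        _ = g * 1 := by rw [← hP, ← hQ, ← this, mul_one]
    have hQ : Q ≠ 0 := by rintro rfl; rw [mul_zero] at e₂; exact hQ0 e₂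
    have hg : g ≠ 0 := by rintro rfl; rw [zero_mul] at e₂; exact hQ0 e₂
    refine ⟨P, Q, hQ, hcop, ?_⟩
    have hg' : aeval t g ≠ 0 := fun h0 => hg (inj (by rw [h0, map_zero]))
    apply mul_left_cancel₀ hg'
    rw [← map_mul, ← e₁, ← mul_assoc, ← map_mul, ← e₂, map_mul, map_mul, ← hD, ← hE]
    simp only [map_pow, aeval_X, pow_one]
    ring
  -- Split off the power of `X` in the denominator, which is invertible in `k[t, 1/t]`; the cofactor
  -- `Q'` must be shown to be a unit.
  obtain ⟨r, Q', hXQ', hQ'⟩ : ∃ (r : ℕ) (Q' : k[X]), IsCoprime X Q' ∧ Q = X ^ r * Q' := by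
    obtain ⟨Q', hQ', hX⟩ := exists_eq_pow_rootMultiplicity_mul_and_not_dvd Q hQ 0
    rw [C_0, sub_zero] at hQ' hX
    exact ⟨_, Q', (irreducible_X.coprime_iff_not_dvd).mpr hX, hQ'⟩
  -- Every `d * y ^ i` has only a power of `t` as denominator, so the fixed numerator `D` of `d`
  -- must cancel `Q' ^ i` for all `i`.
  have hdvd : ∀ i : ℕ, Q' ^ i ∣ D := by
    intro i
    obtain ⟨n, p, -, hp⟩ := exists_isReesForm hBk hb ht0 (h i)
    have e : X ^ n * D * P ^ i = X ^ n₀ * p * Q ^ i := by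
      apply inj
      simp only [map_mul, map_pow, aeval_X, ← hD, ← hp, ← hPQ]
      ring
    have h1 : Q' ^ i ∣ X ^ n * D * P ^ i := by
      rw [e, hQ', mul_pow]
      exact ⟨X ^ n₀ * p * (X ^ r) ^ i, by ring⟩
    have hPQ' : IsCoprime (Q' ^ i) (P ^ i) :=
      (IsCoprime.of_mul_right_right (hQ' ▸ hcop)).symm.pow
    exact (hXQ'.symm.pow (m := i) (n := n)).dvd_of_dvd_mul_left (hPQ'.dvd_of_dvd_mul_right h1)
  have hunit : IsUnit Q' := by
    by_contra hu
    have hfin := (FiniteMultiplicity.of_not_isUnit hu hD0)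
    obtain ⟨m, hm⟩ := hfin
    exact hm (hdvd _)
  obtain ⟨V, hV⟩ := hunit.exists_left_inv
  refine ⟨r, V * P, ?_⟩
  rw [map_mul, ← hPQ, hQ', map_mul, map_pow, aeval_X]
  have : aeval t V * aeval t Q' = 1 := by rw [← map_mul, hV, map_one]
  linear_combination (-(t ^ r) * y) * this

/-- The top coefficient of `D * Y ^ i` is the product of the top coefficients, so the coefficient
condition for `d * y ^ i` at the top degree bounds the powers of `c` uniformly. -/
theorem mul_leadingCoeff_mem (hBk : ∀ x ∈ B, x ∈ k) (hb : b ∈ B) (hb0 : b ≠ 0)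
    (ht : Transcendental k t) {y : K} (hy : IsAlmostIntegral (reesStep B b t) y) {n : ℕ}
    {Y : k[X]} (hY : t ^ n * y = aeval t Y) :
    ∃ c, IsAlmostIntegral B c ∧ (Y.leadingCoeff : K) = b ^ (n - Y.natDegree) * c := by
  have ht0 : t ≠ 0 := ne_zero_of_transcendental ht
  rw [Subalgebra.isAlmostIntegral_iff] at hy
  obtain ⟨d, hd, hd0, h⟩ := hy
  obtain ⟨m, D, hDf, hD⟩ := exists_isReesForm hBk hb ht0 hd
  have hD0 : D ≠ 0 := by
    rintro rfl
    rw [map_zero] at hD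
    exact mul_ne_zero (pow_ne_zero _ ht0) hd0 hD
  have hδ : (D.leadingCoeff : K) ∈ B := by
    obtain ⟨β, hβ, e⟩ := hDf D.natDegree
    rw [coeff_natDegree] at e
    exact e ▸ mul_mem (pow_mem hb _) hβ
  have hδ0 : (D.leadingCoeff : K) ≠ 0 := by
    simpa using hD0
  refine ⟨(Y.leadingCoeff : K) / b ^ (n - Y.natDegree), ?_, by field_simp⟩
  rw [Subalgebra.isAlmostIntegral_iff]
  -- The factor `b ^ D.natDegree` makes up for the powers of `b` lost because `D` has positive
  -- degree.
  refine ⟨D.leadingCoeff * b ^ D.natDegree, mul_mem hδ (pow_mem hb _),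
    mul_ne_zero hδ0 (pow_ne_zero _ hb0), fun i => ?_⟩
  obtain ⟨β, hβ, e⟩ := isReesForm_of_mem_reesStep hBk hb ht (h i) (m := m + n * i)
    (q := D * Y ^ i) (by
      rw [map_mul, map_pow, ← hD, ← hY]
      ring) (D.natDegree + Y.natDegree * i)
  have hc : (D * Y ^ i).coeff (D.natDegree + Y.natDegree * i) =
      D.leadingCoeff * Y.leadingCoeff ^ i := by
    by_cases hY0 : Y = 0
    · rcases Nat.eq_zero_or_pos i with rfl | hi
      · simp
      · simp [hY0, hi.ne']
    · rw [← leadingCoeff_pow, ← leadingCoeff_mul, leadingCoeff,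
        natDegree_mul hD0 (pow_ne_zero _ hY0), natDegree_pow, mul_comm i]
  rw [hc, Subfield.coe_mul, SubmonoidClass.coe_pow] at e
  set f := D.natDegree
  set g := Y.natDegree
  have hle : (n - g) * i ≤ f + (m + n * i - (f + g * i)) := by
    rw [Nat.sub_mul]
    lia
  obtain ⟨j, hj⟩ := Nat.exists_eq_add_of_le hle
  have : (D.leadingCoeff : K) * b ^ f * (Y.leadingCoeff / b ^ (n - g)) ^ i = b ^ j * β := by
    rw [div_pow, ← pow_mul, ← mul_div_assoc, div_eq_iff (pow_ne_zero _ hb0)]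
    calc (D.leadingCoeff : K) * b ^ f * (Y.leadingCoeff : K) ^ i
        = b ^ f * (D.leadingCoeff * (Y.leadingCoeff : K) ^ i) := by ring
      _ = b ^ (f + (m + n * i - (f + g * i))) * β := by rw [e, pow_add]; ring
      _ = b ^ j * β * b ^ ((n - g) * i) := by rw [hj, pow_add]; ring
  rw [this]
  exact mul_mem (pow_mem hb _) hβ

/-- Induction on the number of terms of the numerator, with `n` fixed: the top term of `y` is `c *
z` with `c ∈ B*` and `z ∈ B[t, b / t]`, so subtracting it preserves almost integrality, while `a * c
∈ B` settles the term itself. -/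
theorem mul_mem_reesStep_of_isAlmostIntegral (hBk : ∀ x ∈ B, x ∈ k) (hb : b ∈ B) (hb0 : b ≠ 0)
    (ht : Transcendental k t) {a : K} (haB : ∀ x, IsAlmostIntegral B x → a * x ∈ B)
    {y : K} (hy : IsAlmostIntegral (reesStep B b t) y) : a * y ∈ reesStep B b t := by
  have ht0 : t ≠ 0 := ne_zero_of_transcendental ht
  obtain ⟨n, Y, hY⟩ := exists_pow_mul_eq_aeval hBk hb ht hy
  suffices H : ∀ (N : ℕ) (Y : k[X]) (y : K), Y.support.card = N → t ^ n * y = aeval t Y →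
      IsAlmostIntegral (reesStep B b t) y → a * y ∈ reesStep B b t from H _ Y y rfl hY hy
  intro N
  induction N using Nat.strong_induction_on with
  | _ N ih =>
    intro Y y hN hY hy
    by_cases hY0 : Y = 0
    · have : y = 0 := by simpa [hY0, ht0] using hY
      simp [this]
    obtain ⟨c, hc, e⟩ := mul_leadingCoeff_mem hBk hb hb0 ht hy hY
    set z := b ^ (n - Y.natDegree) * 1 * t ^ Y.natDegree / t ^ n with hz
    have hzS : z ∈ reesStep B b t := monomial_mem_reesStep ht0 (one_mem B) n _
    have hcz : IsAlmostIntegral (reesStep B b t) (c * z) :=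
      (completeIntegralClosure (reesStep B b t) K).mul_mem
        (Subalgebra.isAlmostIntegral_mono (le_reesStep B b t) hc)
        (Subalgebra.isAlmostIntegral_of_mem hzS)
    have hsub : IsAlmostIntegral (reesStep B b t) (y - c * z) :=
      (completeIntegralClosure (reesStep B b t) K).sub_mem hy hcz
    have h1 : a * (y - c * z) ∈ reesStep B b t := by
      refine ih Y.eraseLead.support.card ?_ Y.eraseLead (y - c * z) rfl ?_ hsub
      · rw [← hN]; exact eraseLead_support_card_lt hY0
      · have h2 : aeval t Y = aeval t Y.eraseLead + (Y.leadingCoeff : K) * t ^ Y.natDegree := by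
          conv_lhs => rw [← eraseLead_add_C_mul_X_pow Y]
          rw [map_add, map_mul, map_pow, aeval_C, aeval_X]
          rfl
        rw [mul_sub, hY, h2, e, hz]
        field_simp
        ring
    have h3 : a * c * z ∈ reesStep B b t := mul_mem (le_reesStep B b t (haB c hc)) hzS
    have : a * y = a * (y - c * z) + a * c * z := by ring
    rw [this]
    exact add_mem h1 h3

end ReesStep

namespace ReesTower

/-! ### Algebras indexed by trees of words -/

theorem transcendental_closure {A K : Type*} [CommRing A] [Field K] [Algebra A K] (S : Subalgebra A K) {t : K}
    (ht : Transcendental S t) : Transcendental (Subfield.closure (S : Set K)) t := by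
  let _ : Algebra S (Subfield.closure (S : Set K)) :=
    (RingHom.codRestrict S.val.toRingHom (Subfield.closure (S : Set K))
      fun x => Subfield.subset_closure x.2).toAlgebra
  have : IsScalarTower S (Subfield.closure (S : Set K)) K := IsScalarTower.of_algebraMap_eq' rfl
  have : FaithfulSMul S (Subfield.closure (S : Set K)) := by
    rw [faithfulSMul_iff_algebraMap_injective]
    intro x y h
    exact Subtype.ext (congrArg (fun z : Subfield.closure (S : Set K) => (z : K)) h)
  have : IsFractionRing S (Subfield.closure (S : Set K)) := by
    refine IsFractionRing.of_field S _ fun z => ?_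
    have hz := z.2
    rw [Subfield.mem_closure_iff] at hz
    obtain ⟨x, hx, y, hy, h⟩ := hz
    have hS : Subring.closure (S : Set K) = S.toSubring := Subring.closure_eq S.toSubring
    rw [hS] at hx hy
    exact ⟨⟨x, hx⟩, ⟨y, hy⟩, Subtype.ext h.symm⟩
  exact fun h => ht ((IsFractionRing.isAlgebraic_iff S _ K).mpr h)

open MvPolynomial

variable {A : Type*} [CommRing A] [IsDomain A]

/-- The indeterminates, as elements of the field of rational functions. -/
noncomputable def var (A : Type*) [CommRing A] [IsDomain A] (ε : List Bool) : RatField A :=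
  algebraMap (MvPolynomial (List Bool) A) (RatField A) (X ε)

/-- A set of words containing, with any word, all its prefixes. -/
def IsTree (W : Set (List Bool)) : Prop := ∀ c ε, c :: ε ∈ W → ε ∈ W

/-- The algebra generated by the `T_{ε0}` and `T_{ε1}` for `ε ∈ W`. -/
noncomputable def treeAlg (a : A) (W : Set (List Bool)) : Subalgebra A (RatField A) :=
  Algebra.adjoin A {x | ∃ ε ∈ W, ∃ c, x = T a (c :: ε)}

/-- The field of rational functions in the indeterminates indexed by `W`. -/
noncomputable def ratSubfield (A : Type*) [CommRing A] [IsDomain A] (W : Set (List Bool)) :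
    Subfield (RatField A) :=
  Subfield.closure (Algebra.adjoin A (var A '' W) : Subalgebra A (RatField A))

theorem var_ne_zero (ε : List Bool) : var A ε ≠ 0 := by
  intro h
  exact X_ne_zero (R := A) ε
    ((map_eq_zero_iff _ (IsFractionRing.injective (MvPolynomial (List Bool) A) _)).mp h)

theorem algebraicIndependent_var : AlgebraicIndependent A (var A) :=
  (algebraicIndependent_X (List Bool) A).map'
    (f := IsScalarTower.toAlgHom A (MvPolynomial (List Bool) A) (RatField A))
    (IsFractionRing.injective (MvPolynomial (List Bool) A) _)

theorem algebraMap_injective : Function.Injective (algebraMap A (RatField A)) :=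
  algebraicIndependent_var.algebraMap_injective

theorem transcendental_var {W : Set (List Bool)} {ε : List Bool} (h : ε ∉ W) :
    Transcendental (ratSubfield A W) (var A ε) :=
  transcendental_closure _ (algebraicIndependent_var.transcendental_adjoin h)

theorem ratSubfield_mono {V W : Set (List Bool)} (h : V ⊆ W) :
    ratSubfield A V ≤ ratSubfield A W :=
  Subfield.closure_mono (Algebra.adjoin_mono (Set.image_mono h))

theorem treeAlg_mono (a : A) {V W : Set (List Bool)} (h : V ⊆ W) : treeAlg a V ≤ treeAlg a W :=
  Algebra.adjoin_mono fun _ ⟨ε, hε, c, e⟩ => ⟨ε, h hε, c, e⟩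

theorem algebraMap_mem_ratSubfield (W : Set (List Bool)) (c : A) :
    algebraMap A (RatField A) c ∈ ratSubfield A W :=
  Subfield.subset_closure (Subalgebra.algebraMap_mem _ c)

theorem var_mem_ratSubfield {W : Set (List Bool)} {ε : List Bool} (h : ε ∈ W) :
    var A ε ∈ ratSubfield A W :=
  Subfield.subset_closure (Algebra.subset_adjoin ⟨ε, h, rfl⟩)

theorem T_cons_mem_ratSubfield (a : A) {W : Set (List Bool)} (hW : IsTree W) :
    ∀ (ε : List Bool) (c : Bool), ε ∈ W → T a (c :: ε) ∈ ratSubfield A W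
  | _, false, h => var_mem_ratSubfield h
  | [], true, h => div_mem (algebraMap_mem_ratSubfield W a) (var_mem_ratSubfield h)
  | d :: δ, true, h =>
    div_mem (T_cons_mem_ratSubfield a hW δ d (hW d δ h)) (var_mem_ratSubfield h)

theorem treeAlg_le_ratSubfield (a : A) {W : Set (List Bool)} (hW : IsTree W) :
    ∀ x ∈ treeAlg a W, x ∈ ratSubfield A W := by
  intro x hx
  induction hx using Algebra.adjoin_induction with
  | mem x hx => obtain ⟨ε, h, c, rfl⟩ := hx; exact T_cons_mem_ratSubfield a hW ε c h
  | algebraMap c => exact algebraMap_mem_ratSubfield W c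
  | add x y _ _ hx hy => exact add_mem hx hy
  | mul x y _ _ hx hy => exact mul_mem hx hy

theorem T_ne_zero {a : A} (ha : a ≠ 0) : ∀ ε : List Bool, T a ε ≠ 0
  | [] => fun h => ha ((map_eq_zero_iff _ algebraMap_injective).mp h)
  | false :: ε => var_ne_zero ε
  | true :: ε => div_ne_zero (T_ne_zero ha ε) (var_ne_zero ε)

theorem T_false_mul_T_true (a : A) (ε : List Bool) :
    T a (false :: ε) * T a (true :: ε) = T a ε :=
  mul_div_cancel₀ (T a ε) (var_ne_zero ε)

/-- Adding one word is one step with `b = T_ε`, `t = T_{ε0}`, `b / t = T_{ε1}`. -/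
theorem treeAlg_insert (a : A) (W : Set (List Bool)) (ε : List Bool) :
    treeAlg a (insert ε W) = reesStep (treeAlg a W) (T a ε) (var A ε) := by
  apply le_antisymm
  · refine Algebra.adjoin_le ?_
    rintro x ⟨δ, rfl | hδ, c, rfl⟩
    · cases c
      · exact self_mem_reesStep _ _ _
      · exact div_mem_reesStep _ _ _
    · exact le_reesStep _ _ _ (Algebra.subset_adjoin ⟨δ, hδ, c, rfl⟩)
  · refine Algebra.adjoin_le ?_
    rintro x (hx | rfl | rfl)
    · exact treeAlg_mono a (Set.subset_insert ε W) hx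
    · exact Algebra.subset_adjoin ⟨ε, Set.mem_insert ε W, false, rfl⟩
    · exact Algebra.subset_adjoin ⟨ε, Set.mem_insert ε W, true, rfl⟩

theorem T_mem_treeAlg (a : A) {W : Set (List Bool)} {ε : List Bool}
    (hW : IsTree (insert ε W)) : T a ε ∈ treeAlg a W := by
  cases ε with
  | nil => exact (treeAlg a W).algebraMap_mem a
  | cons c δ =>
    rcases hW c δ (Set.mem_insert _ _) with h | h
    · exact absurd (congrArg List.length h) (by simp)
    · exact Algebra.subset_adjoin ⟨δ, h, c, rfl⟩

/-- A finite enlargement of a tree is built one word at a time. A longest word of `U` outside `V`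
has no extension in the tree, so removing it leaves a tree. -/
theorem IsTree.induction {V : Set (List Bool)} {motive : Set (List Bool) → Prop}
    (base : motive V)
    (step : ∀ W ε, V ⊆ W → IsTree W → IsTree (insert ε W) → ε ∉ W → motive W →
      motive (insert ε W)) (hV : IsTree V)
    (U : Finset (List Bool)) (hU : IsTree (V ∪ U)) : motive (V ∪ U) := by
  classical
  induction hn : U.card using Nat.strong_induction_on generalizing U with
  | _ n ih =>
    by_cases hUV : (U : Set (List Bool)) ⊆ V
    · rwa [Set.union_eq_self_of_subset_right hUV]
    obtain ⟨δ, hδ, hδV⟩ := Set.not_subset.mp hUV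
    obtain ⟨ε, hε, hmax⟩ := (U.filter (· ∉ V)).exists_max_image List.length
      ⟨δ, Finset.mem_filter.mpr ⟨hδ, hδV⟩⟩
    rw [Finset.mem_filter] at hε
    have hins : V ∪ (U : Set (List Bool)) = insert ε (V ∪ (U.erase ε : Finset (List Bool))) := by
      ext x
      by_cases hx : x = ε
      · simp [hx, hε.1]
      · simp [hx]
    have hnot : ε ∉ V ∪ ((U.erase ε : Finset (List Bool)) : Set (List Bool)) := by
      simp [hε.2]
    have htree : IsTree (V ∪ ((U.erase ε : Finset (List Bool)) : Set (List Bool))) := by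
      intro c x hx
      have hx' : c :: x ∈ V ∪ (U : Set (List Bool)) := hins ▸ Set.mem_insert_of_mem _ hx
      have := hU c x hx'
      rw [hins] at this
      refine this.resolve_left ?_
      rintro rfl
      by_cases hcV : c :: x ∈ V
      · exact hε.2 (hV c x hcV)
      · have := hmax (c :: x) (Finset.mem_filter.mpr ⟨hx'.resolve_left hcV, hcV⟩)
        simp at this
    rw [hins]
    rw [hins] at hU
    exact step _ ε Set.subset_union_left htree hU hnot
      (ih _ (hn ▸ Finset.card_erase_lt_of_mem hε.1) _ htree rfl)

theorem isTree_length_lt (n : ℕ) : IsTree {ε : List Bool | ε.length < n} := by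
  intro c ε h
  simp only [Set.mem_ofPred_eq, List.length_cons] at h ⊢
  lia

theorem IsTree.union {V W : Set (List Bool)} (hV : IsTree V) (hW : IsTree W) : IsTree (V ∪ W) :=
  fun c ε h => h.imp (hV c ε) (hW c ε)

/-! ### `R` as the union of the `R_n`, and its complete integral closure -/

theorem Rn_eq_treeAlg (a : A) (n : ℕ) : Rn a n = treeAlg a {ε | ε.length < n} := by
  rw [Rn, treeAlg]
  congr 1
  ext x
  constructor
  · rintro ⟨ε, h1, h2, rfl⟩
    obtain ⟨c, δ, rfl⟩ := List.exists_cons_of_length_pos h1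
    exact ⟨δ, by simpa using h2, c, rfl⟩
  · rintro ⟨δ, h, c, rfl⟩
    exact ⟨c :: δ, by simp, by simpa using h, rfl⟩

theorem R_eq_treeAlg (a : A) : R a = treeAlg a Set.univ := by
  rw [R, treeAlg]
  congr 1
  ext x
  constructor
  · rintro ⟨ε, h1, rfl⟩
    obtain ⟨c, δ, rfl⟩ := List.exists_cons_of_length_pos h1
    exact ⟨δ, trivial, c, rfl⟩
  · rintro ⟨δ, h, c, rfl⟩
    exact ⟨c :: δ, by simp, rfl⟩

theorem Rn_mono (a : A) : Monotone (Rn a) := fun _ _ h =>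
  Algebra.adjoin_mono fun _ ⟨ε, h1, h2, e⟩ => ⟨ε, h1, h2.trans h, e⟩

theorem Rn_le_R (a : A) (n : ℕ) : Rn a n ≤ R a :=
  Algebra.adjoin_mono fun _ ⟨ε, h1, _, e⟩ => ⟨ε, h1, e⟩

theorem T_mem_R (a : A) (ε : List Bool) : T a ε ∈ R a := by
  cases ε with
  | nil => exact (R a).algebraMap_mem a
  | cons c δ => exact Algebra.subset_adjoin ⟨_, by simp, rfl⟩

theorem exists_mem_Rn {a : A} {x : RatField A} (hx : x ∈ R a) : ∃ n, x ∈ Rn a n := by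
  induction hx using Algebra.adjoin_induction with
  | mem x hx =>
    obtain ⟨ε, h, rfl⟩ := hx
    exact ⟨ε.length, Algebra.subset_adjoin ⟨ε, h, le_rfl, rfl⟩⟩
  | algebraMap c => exact ⟨0, (Rn a 0).algebraMap_mem c⟩
  | add x y _ _ hx hy =>
    obtain ⟨n, hn⟩ := hx
    obtain ⟨m, hm⟩ := hy
    exact ⟨n + m, add_mem (Rn_mono a (Nat.le_add_right n m) hn) (Rn_mono a (Nat.le_add_left m n) hm)⟩
  | mul x y _ _ hx hy =>
    obtain ⟨n, hn⟩ := hx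
    obtain ⟨m, hm⟩ := hy
    exact ⟨n + m, mul_mem (Rn_mono a (Nat.le_add_right n m) hn) (Rn_mono a (Nat.le_add_left m n) hm)⟩

/-- `R ∩ k_V` is the algebra of `V`, where `k_V` is the rational function field on `V`: an element
of `R` involves finitely many words, and those outside `V` are removed one by one using `B[t, b / t]
∩ k = B`. -/
theorem mem_treeAlg_of_mem_R {a : A} {V : Set (List Bool)} (hV : IsTree V) {x : RatField A}
    (hx : x ∈ R a) (hxV : x ∈ ratSubfield A V) : x ∈ treeAlg a V := by
  obtain ⟨n, hn⟩ := exists_mem_Rn hx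
  rw [Rn_eq_treeAlg] at hn
  have hfin : {ε : List Bool | ε.length < n}.Finite := List.finite_length_lt Bool n
  have hn' : x ∈ treeAlg a (V ∪ hfin.toFinset) :=
    treeAlg_mono a (by rw [hfin.coe_toFinset]; exact Set.subset_union_right) hn
  refine IsTree.induction (V := V) (motive := fun W => x ∈ treeAlg a W → x ∈ treeAlg a V) id ?_ hV
    hfin.toFinset (by rw [hfin.coe_toFinset]; exact hV.union (isTree_length_lt n)) hn'
  intro W ε hVW hW hins hε ih h
  rw [treeAlg_insert] at h
  exact ih (mem_of_mem_reesStep (treeAlg_le_ratSubfield a hW) (T_mem_treeAlg a hins)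
    (transcendental_var hε) (ratSubfield_mono hVW hxV) h)

theorem mem_ratSubfield_of_isAlmostIntegral {a : A} {W : Set (List Bool)} (hW : IsTree W)
    {x : RatField A} (hx : IsAlmostIntegral (treeAlg a W) x) : x ∈ ratSubfield A W := by
  rw [Subalgebra.isAlmostIntegral_iff] at hx
  obtain ⟨d, hd, hd0, h⟩ := hx
  have h1 := treeAlg_le_ratSubfield a hW _ (h 1)
  have : x = (d * x ^ 1) / d := by field_simp
  rw [this]
  exact div_mem h1 (treeAlg_le_ratSubfield a hW _ hd)

/-- An `n` with `d, d * x ∈ R_n` works for all powers at once, since every `d * x ^ i` then lies in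
`R` and in the rational function field of `R_n`. -/
theorem exists_isAlmostIntegral_Rn {a : A} {x : RatField A} (hx : IsAlmostIntegral (R a) x) :
    ∃ n, IsAlmostIntegral (Rn a n) x := by
  rw [Subalgebra.isAlmostIntegral_iff] at hx
  obtain ⟨d, hd, hd0, h⟩ := hx
  obtain ⟨n₀, h₀⟩ := exists_mem_Rn hd
  obtain ⟨n₁, h₁⟩ := exists_mem_Rn (h 1)
  refine ⟨n₀ + n₁, ?_⟩
  replace h₀ := Rn_mono a (Nat.le_add_right n₀ n₁) h₀
  replace h₁ := Rn_mono a (Nat.le_add_left n₁ n₀) h₁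
  rw [Rn_eq_treeAlg] at *
  have hW := isTree_length_lt (n₀ + n₁)
  have hdk := treeAlg_le_ratSubfield a hW _ h₀
  have hxk : x ∈ ratSubfield A {ε | ε.length < n₀ + n₁} := by
    have : x = (d * x ^ 1) / d := by field_simp
    rw [this]
    exact div_mem (treeAlg_le_ratSubfield a hW _ h₁) hdk
  rw [Subalgebra.isAlmostIntegral_iff]
  exact ⟨d, h₀, hd0, fun i => mem_treeAlg_of_mem_R hW (h i) (mul_mem hdk (pow_mem hxk i))⟩

theorem completeIntegralClosure_R (a : A) :
    (completeIntegralClosure (R a) (RatField A) : Set (RatField A)) =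
      ⋃ n : ℕ, (completeIntegralClosure (Rn a n) (RatField A) : Set (RatField A)) := by
  ext x
  rw [Set.mem_iUnion]
  exact ⟨exists_isAlmostIntegral_Rn,
    fun ⟨n, hn⟩ => Subalgebra.isAlmostIntegral_mono (Rn_le_R a n) hn⟩

/-! ### The conductor of `R` in `R*` -/

theorem treeAlg_empty (a : A) : treeAlg a ∅ = ⊥ := by
  simp [treeAlg]

theorem isTree_empty : IsTree ∅ := fun _ _ h => h

section Conductor

variable {F : Type*} [Field F] [Algebra A F] [IsFractionRing A F]

/-- Base case of the tower: an element almost integral over the image of `A` is a fraction of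
elements of `A`, hence comes from `F`, where the hypothesis on `a` applies. -/
theorem algebraMap_mul_mem_treeAlg_empty {a : A}
    (haA : algebraMap A F a ∈ conductorCompleteIntegralClosure A F) (x : RatField A)
    (hx : IsAlmostIntegral (treeAlg a ∅) x) :
    algebraMap A (RatField A) a * x ∈ treeAlg a ∅ := by
  rw [Subalgebra.isAlmostIntegral_iff, treeAlg_empty] at hx
  rw [treeAlg_empty]
  obtain ⟨d, hd, hd0, h⟩ := hx
  simp only [Algebra.mem_bot, Set.mem_range] at hd h ⊢
  obtain ⟨d, rfl⟩ := hd
  choose f hf using h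
  have hd : d ≠ 0 := by rintro rfl; exact hd0 (map_zero _)
  let φ : F →ₐ[A] RatField A := IsFractionRing.liftAlgHom
    (g := Algebra.ofId A (RatField A)) algebraMap_injective
  have hdF : algebraMap A F d ≠ 0 := fun h0 =>
    hd ((map_eq_zero_iff _ (IsFractionRing.injective A F)).mp h0)
  set z : F := algebraMap A F (f 1) / algebraMap A F d with hz
  have hφz : φ z = x := by
    rw [hz, map_div₀, φ.commutes, φ.commutes, hf 1]
    field_simp
  have hzA : z ∈ completeIntegralClosure A F := by
    refine ⟨d, mem_nonZeroDivisors_of_ne_zero hd, fun i => ⟨f i, φ.injective ?_⟩⟩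
    change φ _ = φ _
    rw [φ.commutes, hf, Algebra.smul_def, map_mul, map_pow, hφz, φ.commutes]
  rw [conductorCompleteIntegralClosure, Submodule.mem_div_iff_forall_mul_mem] at haA
  obtain ⟨y, hy⟩ := Submodule.mem_one.mp (haA z hzA)
  refine ⟨y, ?_⟩
  rw [← φ.commutes y, hy, map_mul, hφz, φ.commutes]

theorem algebraMap_mul_mem_treeAlg {a : A} (ha : a ≠ 0)
    (haA : algebraMap A F a ∈ conductorCompleteIntegralClosure A F)
    (U : Finset (List Bool)) (hU : IsTree (U : Set (List Bool))) (x : RatField A)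
    (hx : IsAlmostIntegral (treeAlg a U) x) : algebraMap A (RatField A) a * x ∈ treeAlg a U := by
  have := IsTree.induction (V := ∅) (motive := fun W => ∀ x, IsAlmostIntegral (treeAlg a W) x →
    algebraMap A (RatField A) a * x ∈ treeAlg a W) (algebraMap_mul_mem_treeAlg_empty haA) ?_
    isTree_empty U (by rwa [Set.empty_union])
  · rw [Set.empty_union] at this
    exact this x hx
  intro W ε _ hW hins hε ih y hy
  rw [treeAlg_insert] at hy ⊢
  exact mul_mem_reesStep_of_isAlmostIntegral (treeAlg_le_ratSubfield a hW) (T_mem_treeAlg a hins)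
    (T_ne_zero ha ε) (transcendental_var hε) ih hy

theorem algebraMap_mul_mem_R {a : A} (ha : a ≠ 0)
    (haA : algebraMap A F a ∈ conductorCompleteIntegralClosure A F) {x : RatField A}
    (hx : IsAlmostIntegral (R a) x) : algebraMap A (RatField A) a * x ∈ R a := by
  obtain ⟨n, hn⟩ := exists_isAlmostIntegral_Rn hx
  apply Rn_le_R a n
  rw [Rn_eq_treeAlg] at *
  have hfin : {ε : List Bool | ε.length < n}.Finite := List.finite_length_lt Bool n
  have := algebraMap_mul_mem_treeAlg ha haA hfin.toFinset
    (by rw [hfin.coe_toFinset]; exact isTree_length_lt n) x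
  rw [hfin.coe_toFinset] at this
  exact this hn

theorem algebraMap_mem_conductor {a : A} (ha : a ≠ 0)
    (haA : algebraMap A F a ∈ conductorCompleteIntegralClosure A F) :
    algebraMap A (RatField A) a ∈ conductorCompleteIntegralClosure (R a) (RatField A) := by
  rw [conductorCompleteIntegralClosure, Submodule.mem_div_iff_forall_mul_mem]
  exact fun y hy => Submodule.mem_one.mpr ⟨⟨_, algebraMap_mul_mem_R ha haA hy⟩, rfl⟩

/-- An element of `A*` that lies in `R` lies in `R ∩ Q(A) = A`. -/
theorem not_isCompletelyIntegrallyClosed_R (hA : ¬ IsCompletelyIntegrallyClosed A F) (a : A) :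
    ¬ IsCompletelyIntegrallyClosed (R a) (RatField A) := by
  intro hR
  refine hA (eq_bot_iff.mpr fun z hz => ?_)
  obtain ⟨d, hd, h⟩ := hz
  let φ : F →ₐ[A] RatField A := IsFractionRing.liftAlgHom
    (g := Algebra.ofId A (RatField A)) algebraMap_injective
  have hai : IsAlmostIntegral (treeAlg a ∅) (φ z) := by
    rw [Subalgebra.isAlmostIntegral_iff]
    refine ⟨algebraMap A _ d, Subalgebra.algebraMap_mem _ d, fun h0 =>
      nonZeroDivisors.ne_zero hd ((map_eq_zero_iff _ algebraMap_injective).mp h0), fun i => ?_⟩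
    obtain ⟨y, hy⟩ := h i
    rw [← φ.commutes d, ← map_pow, ← map_mul, ← Algebra.smul_def, ← hy]
    exact φ.commutes y ▸ Subalgebra.algebraMap_mem _ y
  have hle : treeAlg a ∅ ≤ R a := R_eq_treeAlg a ▸ treeAlg_mono a (Set.empty_subset _)
  have hφR : φ z ∈ completeIntegralClosure (R a) (RatField A) :=
    Subalgebra.isAlmostIntegral_mono hle hai
  rw [IsCompletelyIntegrallyClosed] at hR
  rw [hR, Algebra.mem_bot] at hφR
  obtain ⟨r, hr⟩ := hφR
  have hzR : φ z ∈ R a := hr ▸ r.2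
  have := mem_treeAlg_of_mem_R isTree_empty hzR
    (mem_ratSubfield_of_isAlmostIntegral isTree_empty hai)
  rw [treeAlg_empty, Algebra.mem_bot] at this
  obtain ⟨y, hy⟩ := this
  rw [Algebra.mem_bot]
  exact ⟨y, φ.injective (by change φ _ = φ _; rw [φ.commutes, hy])⟩

/-! ### Absence of strongly divisorial primes -/

theorem not_isStronglyDivisorial {a : A} (ha : a ≠ 0)
    (haA : algebraMap A F a ∈ conductorCompleteIntegralClosure A F) (P : Ideal (R a))
    (hP : P.IsPrime) : ¬ IsStronglyDivisorial (RatField A) P := by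
  rintro ⟨hP0, hstrong, hdiv⟩
  set J := IsLocalization.coeSubmodule (RatField A) P with hJ
  have memJ : ∀ {x : RatField A}, x ∈ J ↔ ∃ y ∈ P, (y : RatField A) = x := by
    intro x
    exact IsLocalization.mem_coeSubmodule (RatField A) P
  have memOne : ∀ {x : RatField A}, x ∈ (1 : Submodule (R a) (RatField A)) ↔ x ∈ R a := by
    intro x
    exact Submodule.mem_one.trans ⟨fun ⟨y, hy⟩ => hy ▸ y.2, fun h => ⟨⟨x, h⟩, rfl⟩⟩
  obtain ⟨d, hd, hd0⟩ := Submodule.exists_mem_ne_zero_of_ne_bot hP0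
  have hdiv_ai : ∀ x ∈ (1 / J : Submodule (R a) (RatField A)), IsAlmostIntegral (R a) x := by
    intro x hx
    rw [hstrong, Submodule.mem_div_iff_forall_mul_mem] at hx
    rw [Subalgebra.isAlmostIntegral_iff]
    refine ⟨d, d.2, fun h0 => hd0 (Subtype.ext h0), fun i => ?_⟩
    have : (d : RatField A) * x ^ i ∈ J := by
      induction i with
      | zero => rw [pow_zero, mul_one]; exact memJ.mpr ⟨d, hd, rfl⟩
      | succ i ih =>
        have := hx _ ih
        rwa [mul_left_comm, ← pow_succ'] at this
    obtain ⟨y, _, hy⟩ := memJ.mp this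
    exact hy ▸ y.2
  have haJ : algebraMap A (RatField A) a ∈ J := by
    rw [← hdiv, Submodule.mem_div_iff_forall_mul_mem]
    exact fun x hx => memOne.mpr (algebraMap_mul_mem_R ha haA (hdiv_ai x hx))
  -- If `(R : P) ⊆ R`, then `1 ∈ (R : (R : P)) = P`.
  obtain ⟨x, hx, hxR⟩ : ∃ x ∈ (1 / J : Submodule (R a) (RatField A)), x ∉ R a := by
    by_contra! hall
    have h1 : (1 : RatField A) ∈ J := by
      rw [← hdiv, Submodule.mem_div_iff_forall_mul_mem]
      exact fun x hx => memOne.mpr (by rw [one_mul]; exact hall x hx)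
    obtain ⟨y, hy, hy1⟩ := memJ.mp h1
    have : y = 1 := Subtype.ext hy1
    exact hP.ne_top ((Ideal.eq_top_iff_one P).mpr (this ▸ hy))
  obtain ⟨n, hn⟩ := exists_isAlmostIntegral_Rn (hdiv_ai x hx)
  have hpath : ∀ m : ℕ, ∃ w : List Bool, w.length = m ∧ T a w ∈ J := by
    intro m
    induction m with
    | zero => exact ⟨[], rfl, haJ⟩
    | succ m ih =>
      obtain ⟨w, hw, hwJ⟩ := ih
      obtain ⟨y, hy, hyw⟩ := memJ.mp hwJ
      have : (⟨T a (false :: w), T_mem_R a _⟩ * ⟨T a (true :: w), T_mem_R a _⟩ : R a) = y :=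
        Subtype.ext ((T_false_mul_T_true a w).trans hyw.symm)
      rw [← this] at hy
      rcases hP.mem_or_mem hy with h | h
      · exact ⟨false :: w, by simp [hw], memJ.mpr ⟨_, h, rfl⟩⟩
      · exact ⟨true :: w, by simp [hw], memJ.mpr ⟨_, h, rfl⟩⟩
  -- Length `n + 1` makes `T_w` one of the two new generators of a single step over `R_n`, at the
  -- word `δ` of length `n`.
  obtain ⟨w, hw, hwJ⟩ := hpath (n + 1)
  obtain ⟨c, δ, rfl⟩ := List.exists_cons_of_length_eq_add_one hw
  have hδ : δ.length = n := by simpa using hw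
  rw [Rn_eq_treeAlg] at hn
  have hW := isTree_length_lt n
  have hins : IsTree (insert δ {ε : List Bool | ε.length < n}) := by
    rintro e ε (h | h)
    · right
      have := congrArg List.length h
      simp only [List.length_cons, Set.mem_ofPred_eq] at this ⊢
      lia
    · exact Or.inr (hW e ε h)
  have hδW : δ ∉ {ε : List Bool | ε.length < n} := by simp [hδ]
  have hxk := mem_ratSubfield_of_isAlmostIntegral hW hn
  have hxT : x * T a (c :: δ) ∈ R a :=
    memOne.mp (Submodule.mem_div_iff_forall_mul_mem.mp hx _ hwJ)
  have hxT' := mem_treeAlg_of_mem_R hins hxT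
    (mul_mem (ratSubfield_mono (Set.subset_insert _ _) hxk)
      (T_cons_mem_ratSubfield a hins δ c (Set.mem_insert _ _)))
  rw [treeAlg_insert] at hxT'
  have hxW : x ∈ treeAlg a {ε : List Bool | ε.length < n} := by
    cases c
    · exact mem_of_mul_mem_reesStep (treeAlg_le_ratSubfield a hW) (T_mem_treeAlg a hins)
        (transcendental_var hδW) hxk hxT'
    · exact mem_of_mul_div_mem_reesStep (treeAlg_le_ratSubfield a hW) (T_mem_treeAlg a hins)
        (T_ne_zero ha δ) (transcendental_var hδW) hxk hxT'
  rw [← Rn_eq_treeAlg] at hxW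
  exact hxR (Rn_le_R a n hxW)

end Conductor

/-! ### Infinite Krull dimension -/

/-- Only indeterminates occur in the denominators of the `T_ε`, so `R` lies in the localization of
the polynomial ring at `q`. -/
theorem exists_mul_eq_algebraMap_of_mem_R (a : A) (q : Ideal (MvPolynomial (List Bool) A))
    [q.IsPrime] (hX : ∀ ε, X ε ∉ q) {x : RatField A} (hx : x ∈ R a) :
    ∃ p s, s ∉ q ∧ x * algebraMap (MvPolynomial (List Bool) A) (RatField A) s =
      algebraMap (MvPolynomial (List Bool) A) (RatField A) p := by
  have h1 : (1 : MvPolynomial (List Bool) A) ∉ q :=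
    fun h => Ideal.IsPrime.ne_top ‹_› ((Ideal.eq_top_iff_one q).mpr h)
  have hC : ∀ c : A, algebraMap A (RatField A) c =
      algebraMap (MvPolynomial (List Bool) A) (RatField A) (C c) := fun c =>
    IsScalarTower.algebraMap_apply A (MvPolynomial (List Bool) A) (RatField A) c
  have hT : ∀ ε, ∃ p s, s ∉ q ∧
      T a ε * algebraMap (MvPolynomial (List Bool) A) (RatField A) s =
        algebraMap (MvPolynomial (List Bool) A) (RatField A) p := by
    intro ε
    induction ε with
    | nil => exact ⟨C a, 1, h1, by rw [map_one, mul_one]; exact hC a⟩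
    | cons c ε ih =>
      cases c
      · exact ⟨X ε, 1, h1, by rw [map_one, mul_one]; rfl⟩
      · obtain ⟨p, s, hs, e⟩ := ih
        refine ⟨p, s * X ε, Ideal.IsPrime.mul_notMem ‹_› hs (hX ε), ?_⟩
        have hv := var_ne_zero (A := A) ε
        rw [← e, map_mul]
        change T a ε / var A ε * (_ * var A ε) = _
        field_simp
  induction hx using Algebra.adjoin_induction with
  | mem x hx => obtain ⟨ε, -, rfl⟩ := hx; exact hT ε
  | algebraMap c => exact ⟨C c, 1, h1, by rw [map_one, mul_one]; exact hC c⟩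
  | add x y _ _ hx hy =>
    obtain ⟨p, s, hs, e⟩ := hx
    obtain ⟨p', s', hs', e'⟩ := hy
    refine ⟨p * s' + p' * s, s * s', Ideal.IsPrime.mul_notMem ‹_› hs hs', ?_⟩
    simp only [map_mul, map_add, ← e, ← e']
    ring
  | mul x y _ _ hx hy =>
    obtain ⟨p, s, hs, e⟩ := hx
    obtain ⟨p', s', hs', e'⟩ := hy
    refine ⟨p * p', s * s', Ideal.IsPrime.mul_notMem ‹_› hs hs', ?_⟩
    simp only [map_mul, ← e, ← e']
    ring

/-- The contraction to `R` of the maximal ideal of the localization of the polynomial ring at a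
prime ideal containing no indeterminate. -/
def extendPrime (a : A) (q : Ideal (MvPolynomial (List Bool) A)) [hq : q.IsPrime]
    (hX : ∀ ε, X ε ∉ q) : Ideal (R a) where
  carrier := {x | ∃ p ∈ q, ∃ s, s ∉ q ∧
    (x : RatField A) * algebraMap (MvPolynomial (List Bool) A) (RatField A) s =
      algebraMap (MvPolynomial (List Bool) A) (RatField A) p}
  zero_mem' := ⟨0, q.zero_mem, 1, fun h => hq.ne_top ((Ideal.eq_top_iff_one q).mpr h), by simp⟩
  add_mem' := by
    rintro x y ⟨p, hp, s, hs, e⟩ ⟨p', hp', s', hs', e'⟩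
    refine ⟨p * s' + p' * s, q.add_mem (q.mul_mem_right _ hp) (q.mul_mem_right _ hp'), s * s',
      hq.mul_notMem hs hs', ?_⟩
    rw [Subalgebra.coe_add]
    simp only [map_mul, map_add, ← e, ← e']
    ring
  smul_mem' := by
    rintro x y ⟨p, hp, s, hs, e⟩
    obtain ⟨p', s', hs', e'⟩ := exists_mul_eq_algebraMap_of_mem_R a q hX x.2
    refine ⟨p' * p, q.mul_mem_left _ hp, s' * s, hq.mul_notMem hs' hs, ?_⟩
    rw [smul_eq_mul, Subalgebra.coe_mul]
    simp only [map_mul, ← e, ← e']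
    ring

theorem algebraMap_mem_R (a : A) (p : MvPolynomial (List Bool) A) :
    algebraMap (MvPolynomial (List Bool) A) (RatField A) p ∈ R a := by
  induction p using MvPolynomial.induction_on with
  | C c =>
    have : algebraMap (MvPolynomial (List Bool) A) (RatField A) (C c) =
        algebraMap A (RatField A) c :=
      (IsScalarTower.algebraMap_apply A (MvPolynomial (List Bool) A) (RatField A) c).symm
    exact this ▸ (R a).algebraMap_mem c
  | add p q hp hq => rw [map_add]; exact add_mem hp hq
  | mul_X p ε hp => rw [map_mul]; exact mul_mem hp (T_mem_R a (false :: ε))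

theorem mk_mem_extendPrime_iff (a : A) (q : Ideal (MvPolynomial (List Bool) A)) [hq : q.IsPrime]
    (hX : ∀ ε, X ε ∉ q) (p : MvPolynomial (List Bool) A) :
    (⟨_, algebraMap_mem_R a p⟩ : R a) ∈ extendPrime a q hX ↔ p ∈ q := by
  constructor
  · rintro ⟨p', hp', s, hs, e⟩
    rw [← map_mul] at e
    have := IsFractionRing.injective (MvPolynomial (List Bool) A) (RatField A) e
    exact (hq.mem_or_mem (this ▸ hp')).resolve_right hs
  · exact fun h => ⟨p, h, 1, fun h => hq.ne_top ((Ideal.eq_top_iff_one q).mpr h), by simp⟩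

theorem isPrime_extendPrime (a : A) (q : Ideal (MvPolynomial (List Bool) A)) [hq : q.IsPrime]
    (hX : ∀ ε, X ε ∉ q) : (extendPrime a q hX).IsPrime := by
  have inj := IsFractionRing.injective (MvPolynomial (List Bool) A) (RatField A)
  constructor
  · rw [Ne, Ideal.eq_top_iff_one]
    rintro ⟨p, hp, s, hs, e⟩
    rw [Subalgebra.coe_one, one_mul] at e
    exact hs (inj e ▸ hp)
  · rintro x y ⟨p, hp, s, hs, e⟩
    obtain ⟨p₁, s₁, hs₁, e₁⟩ := exists_mul_eq_algebraMap_of_mem_R a q hX x.2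
    obtain ⟨p₂, s₂, hs₂, e₂⟩ := exists_mul_eq_algebraMap_of_mem_R a q hX y.2
    have h : p₁ * p₂ * s = p * (s₁ * s₂) := by
      apply inj
      rw [Subalgebra.coe_mul] at e
      simp only [map_mul, ← e, ← e₁, ← e₂]
      ring
    have hmem : p₁ * p₂ ∈ q :=
      (hq.mem_or_mem (h ▸ q.mul_mem_right _ hp)).resolve_right hs
    exact (hq.mem_or_mem hmem).imp (fun h => ⟨p₁, h, s₁, hs₁, e₁⟩) fun h => ⟨p₂, h, s₂, hs₂, e₂⟩

theorem extendPrime_mono (a : A) {q q' : Ideal (MvPolynomial (List Bool) A)} [q.IsPrime]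
    [q'.IsPrime] (hX : ∀ ε, X ε ∉ q) (hX' : ∀ ε, X ε ∉ q') (h : q ≤ q') :
    extendPrime a q hX ≤ extendPrime a q' hX' := by
  intro x hx
  -- The given denominator avoids `q` but may lie in `q'`, so `x` is rewritten with a denominator
  -- outside `q'`; its numerator is still in `q`.
  obtain ⟨p', s', hs', e'⟩ := exists_mul_eq_algebraMap_of_mem_R a q' hX' x.2
  obtain ⟨p, hp, s, hs, e⟩ := hx
  have h1 : p' * s = p * s' := by
    apply IsFractionRing.injective (MvPolynomial (List Bool) A) (RatField A)
    simp only [map_mul, ← e, ← e']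
    ring
  have h2 : p' ∈ q :=
    (Ideal.IsPrime.mem_or_mem ‹_› (h1 ▸ q.mul_mem_right s' hp)).resolve_right hs
  exact ⟨p', h h2, s', hs', e'⟩

/-- The substitution of `1` for the indeterminates of index a word of length less than `n`. -/
noncomputable def substOne (A : Type*) [CommRing A] (n : ℕ) :
    MvPolynomial (List Bool) A →ₐ[A] MvPolynomial (List Bool) A :=
  aeval fun ε => if ε.length < n then 1 else X ε

theorem X_notMem_ker_substOne (n : ℕ) (ε : List Bool) : X ε ∉ RingHom.ker (substOne A n) := by
  rw [RingHom.mem_ker, substOne, aeval_X]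
  split_ifs
  · exact one_ne_zero
  · exact X_ne_zero ε

theorem ker_substOne_strictMono : StrictMono fun n => RingHom.ker (substOne A n) := by
  refine strictMono_nat_of_lt_succ fun n => lt_of_le_of_ne (fun p hp => ?_) fun h => ?_
  · have hcomp : (substOne A (n + 1)).comp (substOne A n) = substOne A (n + 1) := by
      ext1 ε
      simp only [AlgHom.comp_apply, substOne, aeval_X]
      split_ifs with h1 h2
      · rw [map_one]
      · lia
      · rw [aeval_X, if_pos ‹_›]
      · rw [aeval_X, if_neg ‹_›]
    rw [RingHom.mem_ker] at hp ⊢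
    rw [← hcomp, AlgHom.comp_apply, hp, map_zero]
  -- Any word of length exactly `n` separates the two kernels: its indeterminate becomes `1` at
  -- stage `n + 1` but is untouched at stage `n`.
  · have hmem : (X (List.replicate n true) - 1 : MvPolynomial (List Bool) A) ∈
        RingHom.ker (substOne A (n + 1)) := by
      rw [RingHom.mem_ker, map_sub, map_one, substOne, aeval_X, if_pos (by simp), sub_self]
    have hmem' : (X (List.replicate n true) - 1 : MvPolynomial (List Bool) A) ∈
        RingHom.ker (substOne A n) := by
      change RingHom.ker (substOne A n) = RingHom.ker (substOne A (n + 1)) at h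
      rwa [h]
    rw [RingHom.mem_ker, map_sub, map_one, substOne, aeval_X, if_neg (by simp)] at hmem'
    have := congrArg (eval fun _ => (0 : A)) hmem'
    simp at this

instance isPrime_ker_substOne (n : ℕ) : (RingHom.ker (substOne A n)).IsPrime :=
  RingHom.ker_isPrime _

theorem ringKrullDim_R (a : A) : ringKrullDim (R a) = ⊤ := by
  let f : ℕ → PrimeSpectrum (R a) := fun n =>
    ⟨extendPrime a (RingHom.ker (substOne A n)) (X_notMem_ker_substOne n),
      isPrime_extendPrime a _ _⟩
  have hf : StrictMono f := by
    intro m n h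
    have hlt : RingHom.ker (substOne A m) < RingHom.ker (substOne A n) :=
      ker_substOne_strictMono h
    obtain ⟨p, hp, hp'⟩ := Set.exists_of_ssubset hlt
    refine lt_of_le_of_ne (extendPrime_mono a (X_notMem_ker_substOne m)
      (X_notMem_ker_substOne n) hlt.le) fun he => hp' ?_
    rw [SetLike.mem_coe, ← mk_mem_extendPrime_iff a _ (X_notMem_ker_substOne m)]
    have : extendPrime a _ (X_notMem_ker_substOne m) = extendPrime a _ (X_notMem_ker_substOne n) :=
      congrArg PrimeSpectrum.asIdeal he
    rw [this, mk_mem_extendPrime_iff]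
    exact hp
  exact top_le_iff.mp (Order.krullDim_nat ▸ Order.krullDim_le_of_strictMono f hf)

end ReesTower

theorem mainTheorem3 {A F : Type*} [CommRing A] [IsDomain A] [Field F] [Algebra A F]
    [IsFractionRing A F]
    (hA : ¬ IsCompletelyIntegrallyClosed A F)
    (a : A) (ha : a ≠ 0)
    (haA : algebraMap A F a ∈ conductorCompleteIntegralClosure A F) :
    (completeIntegralClosure (ReesTower.R a) (ReesTower.RatField A) : Set (ReesTower.RatField A)) =
        ⋃ n : ℕ, (completeIntegralClosure (ReesTower.Rn a n) (ReesTower.RatField A) :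
          Set (ReesTower.RatField A)) ∧
    ¬ IsCompletelyIntegrallyClosed (ReesTower.R a) (ReesTower.RatField A) ∧
    algebraMap A (ReesTower.RatField A) a ∈
        conductorCompleteIntegralClosure (ReesTower.R a) (ReesTower.RatField A) ∧
    conductorCompleteIntegralClosure (ReesTower.R a) (ReesTower.RatField A) ≠ ⊥ ∧
    (∀ P : Ideal (ReesTower.R a), P.IsPrime → ¬ IsStronglyDivisorial (ReesTower.RatField A) P) ∧
    ringKrullDim (ReesTower.R a) = ⊤ :=
  ⟨ReesTower.completeIntegralClosure_R a,
    ReesTower.not_isCompletelyIntegrallyClosed_R hA a,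
    ReesTower.algebraMap_mem_conductor ha haA,
    fun h => ReesTower.T_ne_zero ha []
      ((Submodule.mem_bot _).mp (h ▸ ReesTower.algebraMap_mem_conductor ha haA)),
    ReesTower.not_isStronglyDivisorial ha haA,
    ReesTower.ringKrullDim_R a⟩
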